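/- Let $L\ge 1$, let $h[1],\dots,h[L]\in\mathbb R$ be relay filter taps, and let $\sigma_w^2\ge 0$, $\sigma_z^2>0$. Let $\{w[k]\}_{k\ge 1}$ (source-to-relay noise) be i.i.d. $\mathcal N(0,\sigma_w^2)$ and $\{z[k]\}_{k\ge 1}$ (source-to-destination noise) be i.i.d. $\mathcal N(0,\sigma_z^2)$, defined on a common probability space, the two processes being independent of each other. For each $N$ let $\mathbf H_N$ be the $N\times N$ lower triangular banded Toeplitz matrix with ones on the diagonal, $h[\ell]$ on the $\ell$-th subdiagonal for $1\le \ell\le L$, and zeros elsewhere. The effective noise process $\{\widetilde z[k]\}_{k\ge 1}$ is defined by $$(\widetilde z[1],\dots,\widetilde z[N])^T=(\mathbf I-\mathbf H_N^{-1})\,(w[1],\dots,w[N])^T+\mathbf H_N^{-1}\,(z[1],\dots,z[N])^T,\qquad N\ge 1,$$ which is consistent in $N$. Then $\{\widetilde z[k]\}_{k\ge 1}$ is a Gaussian process and it is an ARMA$(L,L-1)$ process. Here a process $\{X[k]\}_{k\ge 1}$ is called ARMA$(p,q)$ if there are real numbers $\beta_0=1,\beta_1,\dots,\beta_p$ and $\alpha_0,\dots,\alpha_q$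 and i.i.d. $\mathcal N(0,1)$ random variables $\epsilon[i]$, $i\ge p+1-q$, on the same probability space, such that for every $k\ge p+1$ (that is, whenever $X[k],\dots,X[k-p]$ all belong to the process), almost surely, $$\sum_{j=0}^{p}\beta_jX[k-j]=\sum_{j=0}^{q}\alpha_j\,\epsilon[k-j].$$ -/

import Mathlib

open MeasureTheory ProbabilityTheory
open scoped NNReal Matrix

namespace RelayChannel

/-- White Gaussian noise of variance `v`: the `X i` are independent `N(0, v)` random
variables. -/
structure IsWhiteGaussian {Ω ι : Type*} [MeasurableSpace Ω] (X : ι → Ω → ℝ) (v : ℝ≥0)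
    (P : Measure Ω) : Prop where
  hasLaw : ∀ i, HasLaw (X i) (gaussianReal 0 v) P
  iIndep : iIndepFun X P

/-- The process `X 0, X 1, …` is an ARMA`(p, q)` process:
`∑_{j=0}^p β_j X[k-j] = ∑_{j=0}^q α_j ε[k-j]` almost surely, with `β_0 = 1` and `ε` i.i.d. standard
Gaussian. The equation is required for every `k` for which the terms `X[k], …, X[k-p]` all belong to
the process; since `X` starts at time `0`, these are the `k ≥ p`. The innovations which enter are
the `ε[i]` with `i ≥ p - q`, an integer which may be negative. -/
def IsARMA {Ω : Type*} [MeasurableSpace Ω] (p q : ℕ) (X : ℕ → Ω → ℝ) (P : Measure Ω) : Prop :=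
  ∃ (β α : ℕ → ℝ) (ε : ℤ → Ω → ℝ),
    β 0 = 1 ∧
    IsWhiteGaussian (fun i : Set.Ici ((p : ℤ) - (q : ℤ)) => ε i) 1 P ∧
    ∀ k : ℕ, p ≤ k → ∀ᵐ ω ∂P,
      ∑ j ∈ Finset.range (p + 1), β j * X (k - j) ω
        = ∑ j ∈ Finset.range (q + 1), α j * ε ((k : ℤ) - (j : ℤ)) ω

/-- The `N × N` lower triangular banded Toeplitz matrix `H` with ones on the diagonal and the filter
taps `h 1, …, h L` on the first `L` subdiagonals (other values of `h` do not enter). -/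
def channelMatrix (L : ℕ) (h : ℕ → ℝ) (N : ℕ) : Matrix (Fin N) (Fin N) ℝ :=
  Matrix.of fun i j =>
    if i = j then 1 else if j < i ∧ (i : ℕ) - (j : ℕ) ≤ L then h ((i : ℕ) - (j : ℕ)) else 0

/-- The effective noise vector `(I - H⁻¹) w + H⁻¹ z` of block length `N`. -/
noncomputable def effectiveNoiseVec (L : ℕ) (h : ℕ → ℝ) (N : ℕ) (w z : Fin N → ℝ) : Fin N → ℝ :=
  (1 - (channelMatrix L h N)⁻¹) *ᵥ w + (channelMatrix L h N)⁻¹ *ᵥ z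

/-- The effective noise process: its value at time `k` is the last entry of the effective noise
vector of block length `k + 1`. By `effectiveNoiseVec_apply` below, this is also the entry of
index `k` of the effective noise vector of any block length `N > k`. -/
noncomputable def effectiveNoise {Ω : Type*} (L : ℕ) (h : ℕ → ℝ) (w z : ℕ → Ω → ℝ) (k : ℕ) (ω : Ω) :
    ℝ :=
  effectiveNoiseVec L h (k + 1) (fun i => w i ω) (fun i => z i ω) (Fin.last k)

theorem channelMatrix_det (L : ℕ) (h : ℕ → ℝ) (N : ℕ) : (channelMatrix L h N).det = 1 := by
  rw [Matrix.det_of_isLowerTriangular]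
  · simp [channelMatrix]
  · intro i j hij
    have hij' : i < j := hij
    simp [channelMatrix, hij'.ne, hij'.not_gt]

theorem channelMatrix_mulVec_eq (L : ℕ) (h : ℕ → ℝ) {M N : ℕ} (hMN : M ≤ N) (x : Fin N → ℝ)
    (i : Fin M) :
    (channelMatrix L h M *ᵥ fun j => x (Fin.castLE hMN j)) i
      = (channelMatrix L h N *ᵥ x) (Fin.castLE hMN i) := by
  simp only [Matrix.mulVec, dotProduct]
  rw [← Finset.sum_subset (Finset.subset_univ (Finset.univ.map (Fin.castLEEmb hMN)))]
  · rw [Finset.sum_map]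
    refine Finset.sum_congr rfl fun j _ => ?_
    simp [channelMatrix, Fin.ext_iff, Fin.lt_def, -Fin.val_fin_lt]
  · intro j _ hj
    have hij : ¬ (j : ℕ) < M := fun hlt =>
      hj (Finset.mem_map.2 ⟨⟨j, hlt⟩, Finset.mem_univ _, by ext; simp⟩)
    have hi := i.2
    have h1 : ¬ (i : ℕ) = j := by omega
    have h2 : ¬ (j : ℕ) < i := by omega
    simp [channelMatrix, Fin.ext_iff, Fin.lt_def, -Fin.val_fin_lt, h1, h2]

theorem effectiveNoiseVec_castLE (L : ℕ) (h : ℕ → ℝ) {M N : ℕ} (hMN : M ≤ N) (w z : Fin N → ℝ)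
    (i : Fin M) :
    effectiveNoiseVec L h N w z (Fin.castLE hMN i)
      = effectiveNoiseVec L h M (fun j => w (Fin.castLE hMN j)) (fun j => z (Fin.castLE hMN j)) i := by
  have key : ∀ v : Fin N → ℝ, ((channelMatrix L h N)⁻¹ *ᵥ v) (Fin.castLE hMN i)
      = ((channelMatrix L h M)⁻¹ *ᵥ fun j => v (Fin.castLE hMN j)) i := by
    intro v
    have hN : IsUnit (channelMatrix L h N).det := by simp [channelMatrix_det]
    have hM : IsUnit (channelMatrix L h M).det := by simp [channelMatrix_det]
    have e : (channelMatrix L h M *ᵥ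
        fun j => ((channelMatrix L h N)⁻¹ *ᵥ v) (Fin.castLE hMN j))
        = fun j => v (Fin.castLE hMN j) := by
      ext j
      rw [channelMatrix_mulVec_eq, Matrix.mulVec_mulVec, Matrix.mul_nonsing_inv _ hN,
        Matrix.one_mulVec]
    rw [← e, Matrix.mulVec_mulVec, Matrix.nonsing_inv_mul _ hM, Matrix.one_mulVec]
  simp only [effectiveNoiseVec, Matrix.sub_mulVec, Matrix.one_mulVec, Pi.add_apply, Pi.sub_apply,
    key]

/-- The effective noise process does not depend on the block length. -/
theorem effectiveNoiseVec_apply {Ω : Type*} (L : ℕ) (h : ℕ → ℝ) (w z : ℕ → Ω → ℝ) (ω : Ω) (N : ℕ)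
    (k : Fin N) :
    effectiveNoiseVec L h N (fun i => w i ω) (fun i => z i ω) k = effectiveNoise L h w z k ω :=
  effectiveNoiseVec_castLE L h (Nat.succ_le_of_lt k.2) (fun i => w i ω) (fun i => z i ω)
    (Fin.last (k : ℕ))

end RelayChannel

namespace RelayChannel

open scoped RealInnerProductSpace

/-! ### Hilbert space part: one-sided Wold decomposition of a stationary sequence with finite
covariance range. -/

section Wold

variable {E : Type*} [NormedAddCommGroup E] [InnerProductSpace ℝ E]

/-! Multiplying the effective noise `X` by `H` gives `H X = (H - 1) w + z`. So for `k ≥ L` the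
autoregression with coefficients `1, h 1, …, h L` turns `X` into `Y n = ∑ h (L - l) w (n + l) + z (n
+ L)`, where `n = k - L` (`sum_arCoeff_mul_effectiveNoise`). This sequence is centred, Gaussian and
stationary, with zero covariance from lag `L` on. What remains is to write it as a moving average of
`L` terms of one white noise on the same probability space.

Forward innovations would need an infinite past, which a one-sided process lacks, so time is
reversed: the innovation of `Y n` is its component orthogonal to the closed span of its future. The
shift is an isometry, so the normalised innovations are `e n = U ^ n (e 0)`, and `Y 0` is orthogonal
to the range of `U ^ L`. Hence `Y 0` lies in the span of `e 0, …, e (L - 1)`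
(`exists_moving_average_of_dense`). The innovations are `L²` limits of linear combinations of a
Gaussian process, so orthonormality makes them i.i.d. standard Gaussian
(`isWhiteGaussian_of_orthonormal`). They are nonzero because `z` has positive variance. -/

theorem inner_linearCombination_self (y : ℕ → E) (c : ℕ →₀ ℝ) :
    ⟪Finsupp.linearCombination ℝ y c, Finsupp.linearCombination ℝ y c⟫
      = ∑ i ∈ c.support, ∑ j ∈ c.support, c j * (c i * ⟪y i, y j⟫) := by
  simp only [Finsupp.linearCombination_apply, Finsupp.sum, sum_inner]
  simp only [inner_sum, real_inner_smul_left, real_inner_smul_right]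

/-- The shift of a stationary sequence with dense span extends to a linear isometry. -/
theorem exists_shift_isometry [CompleteSpace E] (y : ℕ → E)
    (hdense : (Submodule.span ℝ (Set.range y)).topologicalClosure = ⊤)
    (hstat : ∀ i j, ⟪y (i + 1), y (j + 1)⟫ = ⟪y i, y j⟫) :
    ∃ U : E →ₗᵢ[ℝ] E, ∀ n, U (y n) = y (n + 1) := by
  set f := Finsupp.linearCombination ℝ fun n => y (n + 1) with hf
  set g := Finsupp.linearCombination ℝ y with hg
  -- Stationarity says that the shift preserves the Gram matrix, hence norms of finite combinations.
  have hnorm : ∀ c, ‖f c‖ = ‖g c‖ := fun c => by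
    rw [← sq_eq_sq₀ (norm_nonneg _) (norm_nonneg _), ← real_inner_self_eq_norm_sq,
      ← real_inner_self_eq_norm_sq, hf, hg, inner_linearCombination_self,
      inner_linearCombination_self]
    simp only [hstat]
  have hd : DenseRange g := by
    have : (LinearMap.range g : Set E) = Set.range g := rfl
    rw [DenseRange, ← this, hg, Finsupp.range_linearCombination,
      Submodule.dense_iff_topologicalClosure_eq_top]
    exact hdense
  have hU : ∀ c, f.extendOfNorm g (g c) = f c := fun c =>
    LinearMap.extendOfNorm_eq hd ⟨1, fun c => by rw [hnorm, one_mul]⟩ c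
  refine ⟨⟨f.extendOfNorm g, fun x => ?_⟩, fun n => ?_⟩
  · change ‖f.extendOfNorm g x‖ = ‖x‖
    refine hd.induction_on x (isClosed_eq (by fun_prop) (by fun_prop)) fun c => ?_
    rw [hU, hnorm]
  · simpa [hf, hg] using hU (Finsupp.single n 1)

theorem eq_zero_on_of_dense_span {F : Type*} [NormedAddCommGroup F] [NormedSpace ℝ F] {y : ℕ → E}
    (hdense : (Submodule.span ℝ (Set.range y)).topologicalClosure = ⊤) {φ : E →L[ℝ] F}
    (hφ : ∀ n, φ (y n) = 0) (x : E) : φ x = 0 := by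
  have : φ = 0 := ContinuousLinearMap.ext_on
    ((Submodule.dense_iff_topologicalClosure_eq_top).2 hdense) (by rintro _ ⟨n, rfl⟩; simp [hφ])
  simp [this]

/-- Moving average representation of a stationary sequence with finitely supported covariance, in a
Hilbert space which the sequence spans. -/
theorem exists_moving_average_of_dense [CompleteSpace E] (y : ℕ → E) (L : ℕ)
    (hdense : (Submodule.span ℝ (Set.range y)).topologicalClosure = ⊤)
    (hstat : ∀ i j, ⟪y (i + 1), y (j + 1)⟫ = ⟪y i, y j⟫)
    (hcov : ∀ n, ⟪y 0, y (n + L)⟫ = 0)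
    (φ : E →L[ℝ] ℝ) (hφ : ∀ n, φ (y (n + 1)) = 0) (hφ0 : φ (y 0) ≠ 0) :
    ∃ (a : ℕ → ℝ) (e : ℕ → E), Orthonormal ℝ e ∧
      ∀ n, y n = ∑ j ∈ Finset.range L, a j • e (n + j) := by
  obtain ⟨U, hU⟩ := exists_shift_isometry y hdense hstat
  have hUn : ∀ n m, (U ^ n) (y m) = y (m + n) := by
    intro n
    induction n with
    | zero => simp
    | succ n ih =>
      intro m
      change (U ^ n) (U (y m)) = _
      rw [hU, ih]
      congr 1
      omega
  set R := LinearMap.range U.toLinearMap with hR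
  have : CompleteSpace R := by
    have : IsComplete (R : Set E) := by
      have h := (U.isometry.isUniformInducing.isComplete_range)
      have hset : (R : Set E) = Set.range U := rfl
      rw [hset]
      exact h
    exact this.completeSpace_coe
  -- The range `R` of `U` is the closed span of `y 1, y 2, …`, so `u` is the backward innovation of
  -- `y 0`.
  set u := y 0 - R.starProjection (y 0) with hu
  have hmem : ∀ x, U x ∈ R := fun x => ⟨x, rfl⟩
  have hu_orth : ∀ x, ⟪u, U x⟫ = 0 := fun x =>
    Submodule.starProjection_inner_eq_zero (K := R) (y 0) (U x) (hmem x)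
  obtain ⟨x₁, hx₁⟩ : ∃ x₁, y 0 = u + U x₁ := by
    obtain ⟨x₁, h⟩ : R.starProjection (y 0) ∈ R := Submodule.starProjection_apply_mem _ _
    exact ⟨x₁, by rw [hu, show U x₁ = _ from h]; abel⟩
  -- `φ` vanishes on the whole future but not at `y 0`, so `y 0` is not in `R`.
  have hφU : ∀ x, φ (U x) = 0 := fun x =>
    eq_zero_on_of_dense_span hdense (φ := φ.comp U.toContinuousLinearMap)
      (fun n => by simpa [hU] using hφ n) x
  have hu0 : u ≠ 0 := fun h => hφ0 (by rw [hx₁, h, zero_add, hφU])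
  set e : ℕ → E := fun n => (U ^ n) (‖u‖⁻¹ • u) with he
  have hadd : ∀ m n x, (U ^ (m + n)) x = (U ^ m) ((U ^ n) x) := fun m n x => by
    rw [pow_add]; rfl
  have he_orth : ∀ j n x, j < n → ⟪e j, (U ^ n) x⟫ = 0 := by
    intro j n x hjn
    obtain ⟨d, rfl⟩ : ∃ d, n = j + (1 + d) := ⟨n - j - 1, by omega⟩
    rw [hadd j, he]
    simp only [LinearIsometry.inner_map_map]
    rw [hadd 1, pow_one, real_inner_smul_left, hu_orth, mul_zero]
  have he_on : Orthonormal ℝ e := by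
    refine ⟨fun n => ?_, fun i j hij => ?_⟩
    · simp [he, norm_smul, hu0]
    · rcases lt_or_gt_of_ne hij with h | h
      · exact he_orth i j _ h
      · rw [real_inner_comm]; exact he_orth j i _ h
  set a : ℕ → ℝ := fun j => ⟪e j, y 0⟫ with ha
  set r := y 0 - ∑ j ∈ Finset.range L, a j • e j with hr
  have hre : ∀ k, k < L → ⟪r, e k⟫ = 0 := by
    intro k hk
    rw [hr, inner_sub_left, sum_inner, Finset.sum_eq_single_of_mem k (by simpa using hk)]
    · rw [real_inner_smul_left, real_inner_self_eq_norm_sq, he_on.1, real_inner_comm, ha]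
      simp
    · intro j _ hj
      rw [real_inner_smul_left, he_on.2 hj, mul_zero]
  have hrL : ∀ x, ⟪r, (U ^ L) x⟫ = 0 := by
    intro x
    have h1 : ⟪y 0, (U ^ L) x⟫ = 0 :=
      eq_zero_on_of_dense_span hdense
        (φ := (innerSL ℝ (y 0)).comp (U ^ L).toContinuousLinearMap)
        (fun n => by simpa [hUn] using hcov n) x
    rw [hr, inner_sub_left, h1, sum_inner, Finset.sum_eq_zero, sub_zero]
    intro j hj
    rw [real_inner_smul_left, he_orth j L x (by simpa using hj), mul_zero]
  -- Descending induction on `k` from `L`: `U ^ k (y 0)` is a multiple of `e k` plus an element of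
  -- the range of `U ^ (k + 1)`, and `U ^ k (y (n + 1))` is already in that range. At `k = 0` the
  -- remainder `r` is orthogonal to itself.
  have hrk : ∀ d k, k + d = L → ∀ x, ⟪r, (U ^ k) x⟫ = 0 := by
    intro d
    induction d with
    | zero => intro k hk x; obtain rfl : k = L := by omega
              exact hrL x
    | succ d ih =>
      intro k hk x
      have ih' := ih (k + 1) (by omega)
      refine eq_zero_on_of_dense_span hdense
        (φ := (innerSL ℝ r).comp (U ^ k).toContinuousLinearMap) (fun n => ?_) x
      change ⟪r, (U ^ k) (y n)⟫ = 0
      cases n with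
      | zero =>
        have h2 : (U ^ k) u = ‖u‖ • e k := by
          simp [he, smul_smul, hu0]
        rw [hx₁, map_add, inner_add_right, h2, real_inner_smul_right, hre k (by omega)]
        simpa [hadd] using ih' x₁
      | succ n => simpa [hadd, hU] using ih' (y n)
  have hr0 : r = 0 := by
    have := hrk L 0 (by omega) r
    simpa using this
  refine ⟨a, e, he_on, fun n => ?_⟩
  have h0 : y 0 = ∑ j ∈ Finset.range L, a j • e j := sub_eq_zero.1 hr0
  have h := hUn n 0
  rw [zero_add] at h
  rw [← h, h0, map_sum]
  refine Finset.sum_congr rfl fun j _ => ?_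
  rw [map_smul, he]
  simp only [hadd]

/-- Moving average representation of a stationary sequence with finitely supported covariance. -/
theorem exists_moving_average [CompleteSpace E] (y : ℕ → E) (L : ℕ)
    (hstat : ∀ i j, ⟪y (i + 1), y (j + 1)⟫ = ⟪y i, y j⟫)
    (hcov : ∀ n, ⟪y 0, y (n + L)⟫ = 0)
    (φ : E →L[ℝ] ℝ) (hφ : ∀ n, φ (y (n + 1)) = 0) (hφ0 : φ (y 0) ≠ 0) :
    ∃ (a : ℕ → ℝ) (e : ℕ → E), Orthonormal ℝ e ∧
      (∀ n, e n ∈ (Submodule.span ℝ (Set.range y)).topologicalClosure) ∧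
      ∀ n, y n = ∑ j ∈ Finset.range L, a j • e (n + j) := by
  -- Working inside the closed span makes the shift everywhere defined and keeps each `e n` a limit
  -- of combinations of `y`.
  set M := (Submodule.span ℝ (Set.range y)).topologicalClosure with hM
  have hyM : ∀ n, y n ∈ M := fun n =>
    Submodule.le_topologicalClosure _ (Submodule.subset_span ⟨n, rfl⟩)
  have hMc : CompleteSpace M := Submodule.topologicalClosure.completeSpace _
  set y' : ℕ → M := fun n => ⟨y n, hyM n⟩ with hy'
  have hdense : (Submodule.span ℝ (Set.range y')).topologicalClosure = ⊤ := by
    rw [← Submodule.dense_iff_topologicalClosure_eq_top, Subtype.dense_iff]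
    intro x hx
    have himg : (Subtype.val '' (Submodule.span ℝ (Set.range y') : Set M))
        = (Submodule.span ℝ (Set.range y) : Set E) := by
      have := Submodule.map_span M.subtype (Set.range y')
      rw [← Set.range_comp] at this
      exact congrArg (fun s : Submodule ℝ E => (s : Set E)) this
    change x ∈ closure (Subtype.val '' (Submodule.span ℝ (Set.range y') : Set M))
    rw [himg]
    exact hx
  obtain ⟨a, e, h1, h2⟩ := exists_moving_average_of_dense y' L hdense hstat hcov
    (φ.comp M.subtypeL) hφ hφ0
  refine ⟨a, fun n => e n, ?_, fun n => (e n).2, fun n => ?_⟩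
  · exact h1.comp_linearIsometry M.subtypeₗᵢ
  · simpa [hy'] using congrArg (Subtype.val) (h2 n)

end Wold

/-! ### Gaussian subspaces of `L²`: closure, and orthonormality versus independence. -/

section GaussianHilbert

variable {Ω : Type*} [MeasurableSpace Ω] {P : Measure Ω} [IsProbabilityMeasure P]

theorem norm_exp_I_mul_sub_le (x y : ℝ) :
    ‖Complex.exp (Complex.I * x) - Complex.exp (Complex.I * y)‖ ≤ ‖x - y‖ := by
  have h : Complex.exp (Complex.I * x) - Complex.exp (Complex.I * y)
      = Complex.exp (Complex.I * y) * (Complex.exp (Complex.I * ((x - y : ℝ) : ℂ)) - 1) := by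
    rw [mul_sub, ← Complex.exp_add]
    push_cast
    ring_nf
  rw [h, norm_mul, Complex.norm_exp_I_mul_ofReal, one_mul]
  exact Real.norm_exp_I_mul_ofReal_sub_one_le

theorem integrable_exp_I_mul {f : Ω → ℝ} (hf : AEMeasurable f P) :
    Integrable (fun ω => Complex.exp (Complex.I * f ω)) P := by
  refine Integrable.of_bound (C := 1) ?_ (Filter.Eventually.of_forall fun ω => ?_)
  · exact (by fun_prop : AEMeasurable (fun ω => Complex.exp (Complex.I * f ω)) P).aestronglyMeasurable
  · rw [Complex.norm_exp_I_mul_ofReal]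

theorem integral_norm_le_norm_Lp_two (f : Lp ℝ 2 P) : ∫ ω, ‖f ω‖ ∂P ≤ ‖f‖ := by
  rw [Lp.norm_def, integral_norm_eq_lintegral_enorm (Lp.aestronglyMeasurable f),
    ← eLpNorm_one_eq_lintegral_enorm]
  exact ENNReal.toReal_mono (Lp.eLpNorm_ne_top f)
    (eLpNorm_le_eLpNorm_of_exponent_le (by norm_num) (Lp.aestronglyMeasurable f))

/-- Since `x ↦ exp (i x)` is 1-Lipschitz and the `L¹` norm is at most the `L²` norm, this map is
1-Lipschitz. It makes the Gaussian characteristic function identity a closed condition. -/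
theorem continuous_integral_exp_I_mul :
    Continuous fun f : Lp ℝ 2 P => ∫ ω, Complex.exp (Complex.I * f ω) ∂P := by
  refine LipschitzWith.continuous (K := 1) (LipschitzWith.of_dist_le_mul fun f g => ?_)
  rw [dist_eq_norm, dist_eq_norm, NNReal.coe_one, one_mul,
    ← integral_sub (integrable_exp_I_mul (Lp.aestronglyMeasurable f).aemeasurable)
      (integrable_exp_I_mul (Lp.aestronglyMeasurable g).aemeasurable)]
  refine le_trans ?_ (integral_norm_le_norm_Lp_two (f - g))
  refine norm_integral_le_of_norm_le ?_ ?_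
  · exact ((Lp.memLp (f - g)).integrable (by norm_num)).norm
  · filter_upwards [Lp.coeFn_sub f g] with ω hω
    rw [hω]
    exact norm_exp_I_mul_sub_le _ _

/-- `f` is a centred Gaussian random variable of variance `‖f‖²`. -/
def IsCentredGaussian (f : Lp ℝ 2 P) : Prop := HasLaw f (gaussianReal 0 (‖f‖₊ ^ 2)) P

omit [IsProbabilityMeasure P] in
theorem IsCentredGaussian.integral_exp {f : Lp ℝ 2 P} (hf : IsCentredGaussian f) :
    ∫ ω, Complex.exp (Complex.I * f ω) ∂P = Complex.exp (-((‖f‖ ^ 2 / 2 : ℝ) : ℂ)) := by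
  have h := charFun_gaussianReal (μ := 0) (v := ‖f‖₊ ^ 2) 1
  rw [← hf.map_eq, charFun_apply_real, integral_map hf.aemeasurable (by fun_prop)] at h
  convert! h using 2
  · ext ω; simp [mul_comm]
  · simp

theorem isCentredGaussian_of_integral_exp {f : Lp ℝ 2 P}
    (h : ∀ t : ℝ, ∫ ω, Complex.exp (Complex.I * (t • f : Lp ℝ 2 P) ω) ∂P
      = Complex.exp (-((‖t • f‖ ^ 2 / 2 : ℝ) : ℂ))) : IsCentredGaussian f := by
  have hm : AEMeasurable f P := (Lp.aestronglyMeasurable f).aemeasurable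
  refine ⟨hm, ?_⟩
  have := Measure.isProbabilityMeasure_map hm
  refine Measure.ext_of_charFun ?_
  ext t
  rw [charFun_gaussianReal, charFun_apply_real, integral_map hm (by fun_prop)]
  have e : ∫ ω, Complex.exp (t * f ω * Complex.I) ∂P
      = ∫ ω, Complex.exp (Complex.I * (t • f : Lp ℝ 2 P) ω) ∂P := by
    refine integral_congr_ae ?_
    filter_upwards [Lp.coeFn_smul t f] with ω hω
    rw [hω, Pi.smul_apply, smul_eq_mul]
    push_cast
    ring_nf
  rw [e, h t, norm_smul]
  congr 1
  push_cast
  rw [mul_pow, ← Complex.ofReal_pow ‖t‖, Real.norm_eq_abs, sq_abs]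
  simp
  ring

/-- The closure of a space of centred Gaussian random variables consists of centred Gaussian
random variables. -/
theorem isCentredGaussian_of_mem_topologicalClosure {S : Submodule ℝ (Lp ℝ 2 P)}
    (hS : ∀ f ∈ S, IsCentredGaussian f) {f : Lp ℝ 2 P} (hf : f ∈ S.topologicalClosure) :
    IsCentredGaussian f := by
  refine isCentredGaussian_of_integral_exp fun t => ?_
  have hcl : IsClosed {g : Lp ℝ 2 P | ∫ ω, Complex.exp (Complex.I * g ω) ∂P
      = Complex.exp (-((‖g‖ ^ 2 / 2 : ℝ) : ℂ))} :=
    isClosed_eq continuous_integral_exp_I_mul (by fun_prop)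
  exact closure_minimal (fun g hg => (hS g hg).integral_exp) hcl
    (S.topologicalClosure.smul_mem t hf)

omit [IsProbabilityMeasure P] in
theorem isCentredGaussian_of_hasGaussianLaw {f : Lp ℝ 2 P} (hf : HasGaussianLaw f P)
    (h0 : ∫ ω, f ω ∂P = 0) : IsCentredGaussian f := by
  refine ⟨hf.aemeasurable, ?_⟩
  have hv : Var[f; P] = ‖f‖ ^ 2 := by
    rw [variance_of_integral_eq_zero hf.aemeasurable h0, ← real_inner_self_eq_norm_sq, L2.inner_def]
    simp [pow_two]
  rw [hf.map_eq_gaussianReal, h0, hv]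
  congr 1
  ext
  simp

omit [IsProbabilityMeasure P] in
theorem isCentredGaussian_of_mem_span {ι : Type*} {X : ι → Ω → ℝ} (hX : IsGaussianProcess X P)
    (h0 : ∀ i, ∫ ω, X i ω ∂P = 0) {y : ι → Lp ℝ 2 P} (hy : ∀ i, y i =ᵐ[P] X i) {f : Lp ℝ 2 P}
    (hf : f ∈ Submodule.span ℝ (Set.range y)) : IsCentredGaussian f := by
  obtain ⟨c, rfl⟩ := Finsupp.mem_span_range_iff_exists_finsupp.1 hf
  have hae : (c.sum fun i a => a • y i : Lp ℝ 2 P) =ᵐ[P]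
      fun ω => ∑ i ∈ c.support, c i • X i ω := by
    have h1 : ∀ᵐ ω ∂P, ∀ i ∈ c.support, (c i • y i : Lp ℝ 2 P) ω = c i • X i ω := by
      refine (Finset.eventually_all _).2 fun i _ => ?_
      filter_upwards [Lp.coeFn_smul (c i) (y i), hy i] with ω h1 h2
      rw [h1, Pi.smul_apply, h2]
    filter_upwards [Lp.coeFn_finsetSum c.support fun i => c i • y i, h1] with ω h2 h3
    rw [Finsupp.sum, h2, Finset.sum_apply]
    exact Finset.sum_congr rfl h3
  refine isCentredGaussian_of_hasGaussianLaw
    (((hX.smul c).hasGaussianLaw_fun_sum (I := c.support)).congr hae.symm) ?_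
  rw [integral_congr_ae hae, integral_finsetSum]
  · exact Finset.sum_eq_zero fun i _ => by rw [integral_smul, h0, smul_zero]
  · exact fun i _ => (hX.hasGaussianLaw_eval i).integrable.smul (c i)

/-- Orthonormal elements of a space of centred Gaussian random variables are independent standard
Gaussian random variables. -/
theorem isWhiteGaussian_of_orthonormal {S : Submodule ℝ (Lp ℝ 2 P)}
    (hS : ∀ f ∈ S, IsCentredGaussian f) {ι : Type*} {e : ι → Lp ℝ 2 P} (he : Orthonormal ℝ e)
    (heS : ∀ i, e i ∈ S) : IsWhiteGaussian (fun i => (e i : Ω → ℝ)) 1 P := by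
  have hmean : ∀ f ∈ S, ∫ ω, f ω ∂P = 0 := fun f hf => by
    simpa using (hS f hf).integral_eq
  have hm : ∀ i, AEMeasurable (e i) P := fun i => (hS _ (heS i)).aemeasurable
  refine ⟨fun i => ?_, ?_⟩
  · have h := hS _ (heS i)
    have h1 : ‖e i‖₊ = 1 := by ext; exact he.1 i
    rwa [IsCentredGaussian, h1, one_pow] at h
  rw [iIndepFun_iff_finset]
  intro I
  have hlaw : HasGaussianLaw (fun ω (i : I) => e i ω) P := by
    -- Joint Gaussianity is tested on linear functionals, each of which yields an element of `S`.
    refine ⟨isGaussian_of_isGaussian_map fun T => ?_⟩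
    rw [AEMeasurable.map_map_of_aemeasurable (by fun_prop) (by fun_prop)]
    classical
    set f : Lp ℝ 2 P := ∑ i : I, T (Pi.single i 1) • e i with hf
    have hfS : f ∈ S := S.sum_mem fun i _ => S.smul_mem _ (heS i)
    have hae : (T ∘ fun ω (i : I) => e i ω) =ᵐ[P] f := by
      have h1 : ∀ᵐ ω ∂P, ∀ i : I, (T (Pi.single i 1) • e i : Lp ℝ 2 P) ω
          = T (Pi.single i 1) • e i ω := by
        refine ae_all_iff.2 fun i => ?_
        filter_upwards [Lp.coeFn_smul (T (Pi.single i 1)) (e i)] with ω h1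
        rw [h1, Pi.smul_apply]
      filter_upwards [Lp.coeFn_finsetSum Finset.univ fun i : I => T (Pi.single i 1) • e i, h1]
        with ω h2 h3
      rw [hf, h2, Finset.sum_apply, Finset.sum_congr rfl fun i _ => h3 i, Function.comp_apply]
      conv_lhs => rw [pi_eq_sum_univ' (fun i : I => e i ω), map_sum]
      refine Finset.sum_congr rfl fun i _ => ?_
      rw [map_smul, smul_eq_mul, smul_eq_mul, mul_comm]
    rw [Measure.map_congr hae, (hS f hfS).map_eq]
    infer_instance
  refine hlaw.iIndepFun_of_covariance_eq_zero fun i j hij => ?_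
  rw [covariance_eq_sub (Lp.memLp _) (Lp.memLp _), hmean _ (heS i), zero_mul, sub_zero]
  have h : ⟪e i, e j⟫ = 0 := he.2 fun h => hij (Subtype.ext h)
  rw [L2.inner_def] at h
  rw [← h]
  refine integral_congr_ae (Filter.Eventually.of_forall fun ω => ?_)
  simp [mul_comm]

end GaussianHilbert

/-! ### The effective noise: autoregression, Gaussianity and the ARMA representation. -/

section EffectiveNoise

variable {Ω : Type*} [MeasurableSpace Ω] {P : Measure Ω} [IsProbabilityMeasure P]

/-- A centred stationary Gaussian sequence whose covariance vanishes from lag `L` on, and whose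
initial term is separated from the later ones by an `L²` random variable, is a moving average of
order `L - 1`. -/
theorem exists_gaussian_moving_average {Y : ℕ → Ω → ℝ} (hY : IsGaussianProcess Y P)
    (h0 : ∀ n, ∫ ω, Y n ω ∂P = 0) {y : ℕ → Lp ℝ 2 P} (hy : ∀ n, y n =ᵐ[P] Y n) (L : ℕ)
    (hstat : ∀ i j, ⟪y (i + 1), y (j + 1)⟫ = ⟪y i, y j⟫)
    (hcov : ∀ n, ⟪y 0, y (n + L)⟫ = 0)
    (g : Lp ℝ 2 P) (hg : ∀ n, ⟪g, y (n + 1)⟫ = 0) (hg0 : ⟪g, y 0⟫ ≠ 0) :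
    ∃ (a : ℕ → ℝ) (e : ℕ → Ω → ℝ), IsWhiteGaussian e 1 P ∧
      ∀ n, ∀ᵐ ω ∂P, Y n ω = ∑ j ∈ Finset.range L, a j * e (n + j) ω := by
  obtain ⟨a, e, he, hemem, hye⟩ :=
    exists_moving_average y L hstat hcov (innerSL ℝ g) hg hg0
  refine ⟨a, fun n => e n, isWhiteGaussian_of_orthonormal
    (fun f hf => isCentredGaussian_of_mem_topologicalClosure
      (fun f hf => isCentredGaussian_of_mem_span hY h0 hy hf) hf) he hemem, fun n => ?_⟩
  have h1 : ∀ᵐ ω ∂P, ∀ j ∈ Finset.range L, (a j • e (n + j) : Lp ℝ 2 P) ω = a j * e (n + j) ω := by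
    refine (Finset.eventually_all _).2 fun j _ => ?_
    filter_upwards [Lp.coeFn_smul (a j) (e (n + j))] with ω h
    rw [h, Pi.smul_apply, smul_eq_mul]
  filter_upwards [hy n, Lp.coeFn_finsetSum (Finset.range L) fun j => a j • e (n + j), h1]
    with ω h2 h3 h4
  rw [← h2, hye n, h3, Finset.sum_apply]
  exact Finset.sum_congr rfl h4

/-- The autoregressive coefficients `1, h 1, …, h L` of the effective noise. -/
def arCoeff (h : ℕ → ℝ) (j : ℕ) : ℝ := if j = 0 then 1 else h j

theorem channelMatrix_mulVec_last (L : ℕ) (h : ℕ → ℝ) (x : ℕ → ℝ) {k : ℕ} (hk : L ≤ k) :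
    (channelMatrix L h (k + 1) *ᵥ fun j => x j) (Fin.last k)
      = ∑ l ∈ Finset.range (L + 1), arCoeff h l * x (k - l) := by
  set F : ℕ → ℝ := fun j =>
    (if k = j then 1 else if j < k ∧ k - j ≤ L then h (k - j) else 0) * x j with hF
  have h1 : (channelMatrix L h (k + 1) *ᵥ fun j => x j) (Fin.last k)
      = ∑ j : Fin (k + 1), F j := by
    simp only [Matrix.mulVec, dotProduct]
    refine Finset.sum_congr rfl fun j _ => ?_
    simp [channelMatrix, hF, Fin.ext_iff, Fin.lt_def, -Fin.val_fin_lt]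
  rw [h1, Fin.sum_univ_eq_sum_range F, ← Finset.sum_range_reflect F]
  have hsub : Finset.range (L + 1) ⊆ Finset.range (k + 1) :=
    Finset.range_subset_range.2 (by omega)
  rw [← Finset.sum_subset hsub]
  · refine Finset.sum_congr rfl fun l hl => ?_
    have hl' : l ≤ L := by simpa [Nat.lt_succ_iff] using hl
    have e1 : k + 1 - 1 - l = k - l := by omega
    have e2 : k - (k - l) = l := by omega
    rw [e1, hF]
    simp only [arCoeff, e2]
    congr 1
    by_cases hl0 : l = 0
    · subst hl0; simp
    · rw [if_neg (by omega), if_pos (by omega), if_neg hl0]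
  · intro l hl hl'
    rw [Finset.mem_range] at hl hl'
    simp only [hF]
    rw [if_neg (by omega), if_neg (by omega), zero_mul]

-- This is row `n + L` of `H X = (H - 1) w + z`; the unit diagonal cancels in `H - 1`, so `w (n +
-- L)` is absent.
omit [MeasurableSpace Ω] in
theorem sum_arCoeff_mul_effectiveNoise (L : ℕ) (h : ℕ → ℝ) (w z : ℕ → Ω → ℝ) (n : ℕ) (ω : Ω) :
    ∑ j ∈ Finset.range (L + 1), arCoeff h j * effectiveNoise L h w z (n + L - j) ω
      = ∑ l ∈ Finset.range L, h (L - l) * w (n + l) ω + z (n + L) ω := by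
  have hk : L ≤ n + L := by omega
  have hdet : IsUnit (channelMatrix L h (n + L + 1)).det := by simp [channelMatrix_det]
  rw [← channelMatrix_mulVec_last L h (fun i => effectiveNoise L h w z i ω) hk]
  have hv : (fun j : Fin (n + L + 1) => effectiveNoise L h w z j ω)
      = effectiveNoiseVec L h (n + L + 1) (fun i => w i ω) (fun i => z i ω) :=
    funext fun j => (effectiveNoiseVec_apply L h w z ω _ j).symm
  rw [hv, effectiveNoiseVec, Matrix.mulVec_add, Matrix.mulVec_mulVec, Matrix.mulVec_mulVec,
    Matrix.mul_sub, Matrix.mul_nonsing_inv _ hdet, Matrix.mul_one, Matrix.sub_mulVec,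
    Matrix.one_mulVec, Matrix.one_mulVec, Pi.add_apply, Pi.sub_apply,
    channelMatrix_mulVec_last L h (fun i => w i ω) hk, Finset.sum_range_succ',
    ← Finset.sum_range_reflect]
  simp only [arCoeff, Fin.val_last, Nat.sub_zero, if_true, one_mul, add_sub_cancel_right]
  congr 1
  refine Finset.sum_congr rfl fun l hl => ?_
  rw [Finset.mem_range] at hl
  have e1 : L - 1 - l + 1 = L - l := by omega
  have e2 : n + L - (L - l) = n + l := by omega
  rw [e1, e2, if_neg (by omega)]

omit [IsProbabilityMeasure P] in
theorem IsWhiteGaussian.hasGaussianLaw_fin {X : ℕ → Ω → ℝ} {v : ℝ≥0} (hX : IsWhiteGaussian X v P)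
    (N : ℕ) : HasGaussianLaw (fun ω (i : Fin N) => X i ω) P :=
  iIndepFun.hasGaussianLaw (X := fun i : Fin N => X i) (fun i => (hX.hasLaw i).hasGaussianLaw)
    (hX.iIndep.precomp Fin.val_injective)

-- Finitely many values are a linear image of one block of `(w, z)`, which is jointly Gaussian by
-- independence.
omit [IsProbabilityMeasure P] in
theorem isGaussianProcess_effectiveNoise (L : ℕ) (h : ℕ → ℝ) {vw vz : ℝ≥0} {w z : ℕ → Ω → ℝ}
    (hw : IsWhiteGaussian w vw P) (hz : IsWhiteGaussian z vz P)
    (hwz : IndepFun (fun ω k => w k ω) (fun ω k => z k ω) P) :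
    IsGaussianProcess (effectiveNoise L h w z) P := by
  refine ⟨fun I => ?_⟩
  set N := I.sup id + 1 with hN
  have hI : ∀ k ∈ I, k < N := fun k hk => Nat.lt_succ_of_le (Finset.le_sup (f := id) hk)
  have hind : IndepFun (fun ω (i : Fin N) => w i ω) (fun ω (i : Fin N) => z i ω) P :=
    hwz.comp (φ := fun (x : ℕ → ℝ) (i : Fin N) => x i)
      (ψ := fun (x : ℕ → ℝ) (i : Fin N) => x i)
      (by fun_prop) (by fun_prop)
  have hjoint := hind.hasGaussianLaw (hw.hasGaussianLaw_fin N) (hz.hasGaussianLaw_fin N)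
  let T : ((Fin N → ℝ) × (Fin N → ℝ)) →ₗ[ℝ] (I → ℝ) :=
    { toFun := fun p k => effectiveNoiseVec L h N p.1 p.2 ⟨k, hI k k.2⟩
      map_add' := fun p q => by
        ext k; simp only [effectiveNoiseVec, Prod.fst_add, Prod.snd_add, Matrix.mulVec_add,
          Pi.add_apply]; ring
      map_smul' := fun c p => by
        ext k; simp [effectiveNoiseVec, Matrix.mulVec_smul, mul_add] }
  convert! hjoint.map T.toContinuousLinearMap using 1
  ext ω k
  exact (effectiveNoiseVec_apply L h w z ω N ⟨k, hI k k.2⟩).symm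

omit [IsProbabilityMeasure P] in
theorem IsWhiteGaussian.memLp {ι : Type*} {X : ι → Ω → ℝ} {v : ℝ≥0} (hX : IsWhiteGaussian X v P)
    (i : ι) : MemLp (X i) 2 P := (hX.hasLaw i).hasGaussianLaw.memLp_two

omit [IsProbabilityMeasure P] in
theorem IsWhiteGaussian.integral_eq_zero {ι : Type*} {X : ι → Ω → ℝ} {v : ℝ≥0}
    (hX : IsWhiteGaussian X v P) (i : ι) : ∫ ω, X i ω ∂P = 0 := by
  simpa using (hX.hasLaw i).integral_eq

omit [IsProbabilityMeasure P] in
theorem inner_toLp {f g : Ω → ℝ} (hf : MemLp f 2 P) (hg : MemLp g 2 P) :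
    ⟪hf.toLp f, hg.toLp g⟫ = ∫ ω, f ω * g ω ∂P := by
  rw [L2.inner_def]
  refine integral_congr_ae ?_
  filter_upwards [hf.coeFn_toLp, hg.coeFn_toLp] with ω h1 h2
  rw [h1, h2]
  simp [mul_comm]

omit [IsProbabilityMeasure P] in
theorem IsWhiteGaussian.inner_toLp {ι : Type*} [DecidableEq ι] {X : ι → Ω → ℝ} {v : ℝ≥0}
    (hX : IsWhiteGaussian X v P) (i j : ι) :
    ⟪(hX.memLp i).toLp (X i), (hX.memLp j).toLp (X j)⟫ = if i = j then (v : ℝ) else 0 := by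
  rw [RelayChannel.inner_toLp]
  split_ifs with hij
  · subst hij
    have h := (hX.hasLaw i).variance_eq
    rw [variance_of_integral_eq_zero (hX.hasLaw i).aemeasurable (hX.integral_eq_zero i),
      variance_id_gaussianReal] at h
    rw [← h]
    simp [pow_two]
  · have h := (hX.iIndep.indepFun hij).integral_mul_eq_mul_integral
      (hX.memLp i).aestronglyMeasurable (hX.memLp j).aestronglyMeasurable
    rw [hX.integral_eq_zero i, zero_mul] at h
    exact h

theorem isARMA_effectiveNoise (L : ℕ) (hL : 1 ≤ L) (h : ℕ → ℝ) {vw vz : ℝ≥0} (hvz : vz ≠ 0)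
    {w z : ℕ → Ω → ℝ} (hw : IsWhiteGaussian w vw P) (hz : IsWhiteGaussian z vz P)
    (hwz : IndepFun (fun ω k => w k ω) (fun ω k => z k ω) P) :
    IsARMA L (L - 1) (effectiveNoise L h w z) P := by
  set gw : ℕ → Lp ℝ 2 P := fun i => (hw.memLp i).toLp (w i) with hgw
  set gz : ℕ → Lp ℝ 2 P := fun i => (hz.memLp i).toLp (z i) with hgz
  have hww : ∀ i j, ⟪gw i, gw j⟫ = if i = j then (vw : ℝ) else 0 := hw.inner_toLp
  have hzz : ∀ i j, ⟪gz i, gz j⟫ = if i = j then (vz : ℝ) else 0 := hz.inner_toLp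
  have hwz0 : ∀ i j, ⟪gw i, gz j⟫ = 0 := fun i j => by
    rw [inner_toLp]
    have hij : IndepFun (w i) (z j) P :=
      hwz.comp (measurable_pi_apply i) (measurable_pi_apply j)
    have h := hij.integral_mul_eq_mul_integral
      (hw.memLp i).aestronglyMeasurable (hz.memLp j).aestronglyMeasurable
    rw [hw.integral_eq_zero i, zero_mul] at h
    exact h
  have hzw0 : ∀ i j, ⟪gz i, gw j⟫ = 0 := fun i j => by rw [real_inner_comm, hwz0]
  set y : ℕ → Lp ℝ 2 P := fun n =>
    ∑ l ∈ Finset.range L, h (L - l) • gw (n + l) + gz (n + L) with hy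
  set Y : ℕ → Ω → ℝ := fun n ω =>
    ∑ l ∈ Finset.range L, h (L - l) * w (n + l) ω + z (n + L) ω with hYdef
  have hyY : ∀ n, y n =ᵐ[P] Y n := by
    intro n
    have h1 : ∀ᵐ ω ∂P, ∀ l ∈ Finset.range L, (h (L - l) • gw (n + l) : Lp ℝ 2 P) ω
        = h (L - l) * w (n + l) ω := by
      refine (Finset.eventually_all _).2 fun l _ => ?_
      filter_upwards [Lp.coeFn_smul (h (L - l)) (gw (n + l)), (hw.memLp (n + l)).coeFn_toLp]
        with ω h2 h3
      rw [h2, Pi.smul_apply, smul_eq_mul, h3]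
    filter_upwards [Lp.coeFn_add (∑ l ∈ Finset.range L, h (L - l) • gw (n + l)) (gz (n + L)),
      Lp.coeFn_finsetSum (Finset.range L) fun l => h (L - l) • gw (n + l),
      (hz.memLp (n + L)).coeFn_toLp, h1] with ω h2 h3 h4 h5
    rw [hy, h2, Pi.add_apply, h3, Finset.sum_apply, Finset.sum_congr rfl h5, h4]
  have hinner : ∀ i j, ⟪y i, y j⟫ = ∑ l ∈ Finset.range L, ∑ m ∈ Finset.range L,
      h (L - l) * (h (L - m) * if i + l = j + m then (vw : ℝ) else 0)
        + if i + L = j + L then (vz : ℝ) else 0 := by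
    intro i j
    simp only [hy, inner_add_left, inner_add_right, sum_inner, real_inner_smul_left, hwz0, hzz]
    simp only [inner_sum, real_inner_smul_right, hzw0, hww, mul_zero, Finset.sum_const_zero,
      add_zero, zero_add, Finset.mul_sum]
  have hgy : ∀ n, ⟪gz L, y n⟫ = if L = n + L then (vz : ℝ) else 0 := by
    intro n
    simp only [hy, inner_add_right, inner_sum, real_inner_smul_right, hzw0, hzz, mul_zero,
      Finset.sum_const_zero, zero_add]
  have hX := isGaussianProcess_effectiveNoise L h hw hz hwz
  have hYg : IsGaussianProcess Y P := by
    -- `Y n` inherits Gaussianity as a finite linear combination of effective noise values.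
    refine hX.of_isGaussianProcess fun n => ⟨Finset.range (n + L + 1),
      ∑ j ∈ Finset.range (L + 1), arCoeff h j • ContinuousLinearMap.proj
        ⟨n + L - j, Finset.mem_range.2 (by omega)⟩, fun ω => ?_⟩
    rw [hYdef]
    simp only
    rw [← sum_arCoeff_mul_effectiveNoise]
    simp
  have hY0 : ∀ n, ∫ ω, Y n ω ∂P = 0 := by
    intro n
    have hi : ∀ l ∈ Finset.range L, Integrable (fun ω => h (L - l) * w (n + l) ω) P :=
      fun l _ => ((hw.memLp (n + l)).integrable (by norm_num)).const_mul _
    rw [hYdef]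
    simp only
    rw [integral_add (integrable_finsetSum _ hi) ((hz.memLp _).integrable (by norm_num)),
      integral_finsetSum _ hi, hz.integral_eq_zero, add_zero]
    exact Finset.sum_eq_zero fun l _ => by
      rw [integral_const_mul, hw.integral_eq_zero, mul_zero]
  obtain ⟨a, e, he, hYe⟩ := exists_gaussian_moving_average hYg hY0 hyY L
    (fun i j => by
      simp only [hinner, show ∀ l m, i + 1 + l = j + 1 + m ↔ i + l = j + m by intros; omega])
    (fun n => by
      rw [hinner, if_neg (by omega), add_zero]
      refine Finset.sum_eq_zero fun l hl => Finset.sum_eq_zero fun m _ => ?_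
      rw [Finset.mem_range] at hl
      rw [if_neg (by omega), mul_zero, mul_zero])
    -- The variable `z L` enters `Y 0` and no later `Y n`, so it separates `y 0` from its future.
    (gz L) (fun n => by rw [hgy, if_neg (by omega)])
    (by rw [hgy, if_pos (by omega)]; exact_mod_cast hvz)
  -- The sum over `e (n + j)` is reversed to run backwards in time. With `k = n + L` the latest
  -- innovation is `e (k - 1)`, hence the shift by one. The innovation indices start at `L - (L - 1)
  -- = 1`, where `toNat` loses nothing.
  refine ⟨arCoeff h, fun j => a (L - 1 - j), fun i => e (i - 1).toNat, by simp [arCoeff], ?_,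
    fun k hk => ?_⟩
  · have hinj : Function.Injective
        fun i : Set.Ici ((L : ℤ) - ((L - 1 : ℕ) : ℤ)) => ((i : ℤ) - 1).toNat := by
      rintro ⟨i, hi⟩ ⟨j, hj⟩ hij
      simp only [Set.mem_Ici] at hi hj hij
      exact Subtype.ext (by simp only; omega)
    exact ⟨fun i => he.hasLaw _, he.iIndep.precomp hinj⟩
  · obtain ⟨n, rfl⟩ : ∃ n, k = n + L := ⟨k - L, by omega⟩
    filter_upwards [hYe n] with ω hω
    rw [sum_arCoeff_mul_effectiveNoise]
    refine hω.trans ?_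
    rw [Nat.sub_add_cancel hL, ← Finset.sum_range_reflect]
    refine Finset.sum_congr rfl fun j hj => ?_
    rw [Finset.mem_range] at hj
    have e1 : (((n + L : ℕ) : ℤ) - (j : ℤ) - 1).toNat = n + (L - 1 - j) := by omega
    rw [e1]

end EffectiveNoise

end RelayChannel

theorem mainTheorem3 {Ω : Type*} [MeasurableSpace Ω] (P : Measure Ω) [IsProbabilityMeasure P]
    (L : ℕ) (hL : 1 ≤ L) (h : ℕ → ℝ) (vw vz : ℝ≥0) (hvz : vz ≠ 0) (w z : ℕ → Ω → ℝ)
    (hw : RelayChannel.IsWhiteGaussian w vw P) (hz : RelayChannel.IsWhiteGaussian z vz P)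
    (hwz : IndepFun (fun ω k => w k ω) (fun ω k => z k ω) P) :
    RelayChannel.IsARMA L (L - 1) (RelayChannel.effectiveNoise L h w z) P ∧
      IsGaussianProcess (RelayChannel.effectiveNoise L h w z) P :=
  ⟨RelayChannel.isARMA_effectiveNoise L hL h hvz hw hz hwz,
    RelayChannel.isGaussianProcess_effectiveNoise L h hw hz hwz⟩
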